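/- Let $K^{t}$ denote the complete graph on $t$ vertices. The Cartesian product $G_1\times G_2$ of two graphs is the graph on the pairs $(v_1,v_2)$ with $v_1\in V(G_1)$ and $v_2\in V(G_2)$, in which $(u_1,u_2)$ and $(v_1,v_2)$ are adjacent if either $u_1v_1\in E(G_1)$ and $u_2=v_2$, or $u_1=v_1$ and $u_2v_2\in E(G_2)$. A graph is called $k$-linked if it has at least $2k$ vertices and, for every choice of $2k$ distinct vertices and every arrangement of them into $k$ pairs $\{s_1,t_1\},\ldots,\{s_k,t_k\}$, there are pairwise vertex-disjoint paths $P_1,\ldots,P_k$ in the graph such that $P_i$ joins $s_i$ and $t_i$ for each $i$. **Theorem.** For all integers $d_1,d_2\ge 0$, the Cartesian product $K^{d_1+1}\times K^{d_2+1}$ of complete graphs is $\lfloor (d_1+d_2)/2\rfloor$-linked. -/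

import Mathlib

/-- The pairs `{s i, t i}`, `i : Fin k`, are linked in `G`: there are paths `P i` of `G` from `s i`
to `t i` that are pairwise vertex-disjoint. -/
def LinkedPairs {V : Type*} (G : SimpleGraph V) {k : ℕ} (s t : Fin k → V) : Prop :=
  ∃ P : (i : Fin k) → G.Walk (s i) (t i),
    (∀ i, (P i).IsPath) ∧
    ∀ i j, i ≠ j → List.Disjoint (P i).support (P j).support

/-- A finite graph is `k`-linked if it has at least `2k` vertices and every labelling and pairing
`{s 0, t 0}, …, {s (k-1), t (k-1)}` of `2k` distinct vertices is linked. Injectivity of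
`Sum.elim s t` says that the `2k` terminals are distinct. -/
def IsKLinked {V : Type*} [Fintype V] (G : SimpleGraph V) (k : ℕ) : Prop :=
  2 * k ≤ Fintype.card V ∧
    ∀ s t : Fin k → V, Function.Injective (Sum.elim s t) → LinkedPairs G s t

/-! Pairs are linked by rook moves in a finite grid `R × C`, by induction on `#R + #C`, whenever `2
* #I + 2 ≤ #R + #C`. Terminals of a deleted row slide within their columns to free cells of the
remaining rows, which works while no column is too crowded (`GridLinked.of_subset_rows`).

If the inequality is strict, a row or a column can be deleted: a column and a row both full of
terminals would hold too many, as they share only one cell.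

If equality holds, a pair may be joined inside its two rows through a common free column, and
deleted with these rows; the same holds for columns. When this never applies, the other two corners
of the rectangle of each pair are terminals of other pairs, so every occupied line has at least two
terminals; moreover, all columns or all rows are occupied. Say all columns are. Then there are so
many empty rows that a greedy colouring sends each pair through one of them, with different rows for
pairs that share a column (`GridLinked.of_no_empty_col`). -/

open Finset

/-- Two cells of a grid lie in a common row or column. -/
def SameLine {α β : Type*} (u v : α × β) : Prop := u.1 = v.1 ∨ u.2 = v.2

/-- `u` and `v` are joined by a sequence of rook moves through cells of `A`. -/
def GridJoined {α β : Type*} (A : Set (α × β)) (u v : α × β) : Prop :=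
  u ∈ A ∧ Relation.ReflTransGen (fun x y => y ∈ A ∧ SameLine x y) u v

/-- `T` places the terminals `(i, false)`, `(i, true)`, for `i ∈ I`, in distinct cells of `R × C`. -/
structure Placement {α β ι : Type*} (R : Finset α) (C : Finset β) (I : Finset ι)
    (T : ι × Bool → α × β) : Prop where
  row_mem : ∀ i ∈ I, ∀ b, (T (i, b)).1 ∈ R
  col_mem : ∀ i ∈ I, ∀ b, (T (i, b)).2 ∈ C
  inj : ∀ i ∈ I, ∀ j ∈ I, ∀ b b', T (i, b) = T (j, b') → i = j ∧ b = b'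

/-- The pairs with index in `I` are joined inside disjoint sets of cells of `R × C`. -/
def GridLinked {α β ι : Type*} (R : Finset α) (C : Finset β) (I : Finset ι)
    (T : ι × Bool → α × β) : Prop :=
  ∃ A : ι → Set (α × β),
    (∀ i ∈ I, (∀ x ∈ A i, x.1 ∈ R ∧ x.2 ∈ C) ∧ GridJoined (A i) (T (i, false)) (T (i, true))) ∧
    ∀ i ∈ I, ∀ j ∈ I, i ≠ j → Disjoint (A i) (A j)

/-- The cells occupied by terminals with index in `I`. -/
def terminals {α β ι : Type*} [DecidableEq α] [DecidableEq β] (I : Finset ι)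
    (T : ι × Bool → α × β) : Finset (α × β) :=
  (I ×ˢ (univ : Finset Bool)).image T

/-! ### Rook-move paths, placements, and sliding terminals along columns. -/

section Basic

variable {α β ι : Type*}

theorem GridJoined.refl {A : Set (α × β)} {u : α × β} (hu : u ∈ A) : GridJoined A u u := ⟨hu, .refl⟩

theorem GridJoined.left_mem {A : Set (α × β)} {u v : α × β} (h : GridJoined A u v) : u ∈ A := h.1

theorem GridJoined.right_mem {A : Set (α × β)} {u v : α × β} (h : GridJoined A u v) : v ∈ A := by
  obtain ⟨hu, h⟩ := h
  induction h with
  | refl => exact hu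
  | tail _ h _ => exact h.1

theorem GridJoined.tail {A : Set (α × β)} {u v w : α × β} (h : GridJoined A u v) (hw : w ∈ A)
    (hvw : SameLine v w) : GridJoined A u w := ⟨h.1, h.2.tail ⟨hw, hvw⟩⟩

theorem GridJoined.head {A : Set (α × β)} {u v w : α × β} (hu : u ∈ A)
    (huv : SameLine u v) (h : GridJoined A v w) : GridJoined A u w := ⟨hu, h.2.head ⟨h.1, huv⟩⟩

theorem GridJoined.mono {A B : Set (α × β)} (hAB : A ⊆ B) {u v : α × β} (h : GridJoined A u v) :
    GridJoined B u v :=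
  ⟨hAB h.1, h.2.lift id fun _ _ h => ⟨hAB h.1, h.2⟩⟩

theorem GridJoined.swap {A : Set (α × β)} {u v : α × β} (h : GridJoined A u v) :
    GridJoined (Prod.swap ⁻¹' A) u.swap v.swap :=
  ⟨h.1, h.2.lift Prod.swap fun _ _ h => ⟨h.1, Or.symm h.2⟩⟩

theorem Placement.swap {R : Finset α} {C : Finset β} {I : Finset ι} {T : ι × Bool → α × β}
    (h : Placement R C I T) : Placement C R I (Prod.swap ∘ T) where
  row_mem := h.col_mem
  col_mem := h.row_mem
  inj i hi j hj b b' hb := h.inj i hi j hj b b' (Prod.swap_injective hb)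

theorem Placement.mono {R : Finset α} {C : Finset β} {I J : Finset ι} {T : ι × Bool → α × β}
    (h : Placement R C I T) (hJ : J ⊆ I) : Placement R C J T where
  row_mem i hi := h.row_mem i (hJ hi)
  col_mem i hi := h.col_mem i (hJ hi)
  inj i hi j hj := h.inj i (hJ hi) j (hJ hj)

theorem GridLinked.swap {R : Finset α} {C : Finset β} {I : Finset ι} {T : ι × Bool → α × β}
    (h : GridLinked R C I T) : GridLinked C R I (Prod.swap ∘ T) := by
  obtain ⟨A, hA, hd⟩ := h
  refine ⟨fun i => Prod.swap ⁻¹' A i, fun i hi => ⟨fun x hx => ?_, (hA i hi).2.swap⟩,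
    fun i hi j hj hij => (hd i hi j hj hij).preimage _⟩
  exact ((hA i hi).1 _ hx).symm

variable [DecidableEq α] [DecidableEq β]

theorem mem_terminals {I : Finset ι} {T : ι × Bool → α × β} {x : α × β} :
    x ∈ terminals I T ↔ ∃ i ∈ I, ∃ b, T (i, b) = x := by
  simp only [terminals, mem_image, mem_product, mem_univ, and_true, Prod.exists]
  constructor
  · rintro ⟨i, b, hi, h⟩
    exact ⟨i, hi, b, h⟩
  · rintro ⟨i, hi, b, h⟩
    exact ⟨i, b, hi, h⟩

theorem mem_terminals_swap {I : Finset ι} {T : ι × Bool → α × β} {x : β × α} :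
    x ∈ terminals I (Prod.swap ∘ T) ↔ x.swap ∈ terminals I T := by
  simp only [mem_terminals, Function.comp, Prod.swap_eq_iff_eq_swap]

theorem card_filter_terminals_swap {I : Finset ι} {T : ι × Bool → α × β}
    (p : β × α → Prop) [DecidablePred p] :
    #{x ∈ terminals I (Prod.swap ∘ T) | p x} = #{x ∈ terminals I T | p x.swap} := by
  refine card_bij' (fun x _ => x.swap) (fun x _ => x.swap) ?_ ?_ (by simp) (by simp)
  · intro x hx
    simpa [mem_terminals_swap] using hx
  · intro x hx
    simpa [mem_terminals_swap] using hx

theorem Placement.card_terminals {R : Finset α} {C : Finset β} {I : Finset ι}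
    {T : ι × Bool → α × β} (h : Placement R C I T) : #(terminals I T) = 2 * #I := by
  rw [terminals, card_image_of_injOn, card_product, card_univ, Fintype.card_bool, mul_comm]
  rintro ⟨i, b⟩ hi ⟨j, b'⟩ hj hij
  simp only [coe_product, Set.mem_prod, mem_coe] at hi hj
  obtain ⟨rfl, rfl⟩ := h.inj i hi.1 j hj.1 b b' hij
  rfl

/-- A row and a column share at most one cell of `X`. -/
theorem card_col_add_card_row_le (X : Finset (α × β)) (r : α) (c : β) :
    #{x ∈ X | x.2 = c} + #{x ∈ X | x.1 = r} ≤ #X + 1 := by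
  rw [← card_union_add_card_inter]
  refine Nat.add_le_add (card_le_card (union_subset (filter_subset _ _) (filter_subset _ _))) ?_
  rw [card_le_one]
  intro x hx y hy
  simp only [mem_inter, mem_filter] at hx hy
  exact Prod.ext (hx.2.2.trans hy.2.2.symm) (hx.1.2.trans hy.1.2.symm)

/-- A set of cardinality at most `#S` is moved injectively into `S`, fixing the points of `S`. -/
theorem exists_injOn_mapsTo_fix (X S : Finset α) (h : #X ≤ #S) :
    ∃ f : α → α, (∀ x ∈ X, f x ∈ S) ∧ (∀ x ∈ X, ∀ y ∈ X, f x = f y → x = y) ∧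
      ∀ x ∈ S, f x = x := by
  have h1 : #(X \ S) ≤ #(S \ X) := by
    have := card_sdiff_add_card_inter X S
    have := card_sdiff_add_card_inter S X
    rw [inter_comm] at this
    omega
  obtain ⟨Y, hY, hcard⟩ := exists_subset_card_eq h1
  let e := Finset.equivOfCardEq hcard.symm
  have he : ∀ x (hx : x ∈ X \ S), (e ⟨x, hx⟩ : α) ∈ S ∧ (e ⟨x, hx⟩ : α) ∉ X := fun x hx =>
    mem_sdiff.1 (hY (e ⟨x, hx⟩).2)
  refine ⟨fun x => if hx : x ∈ X \ S then e ⟨x, hx⟩ else x, fun x hx => ?_, fun x hx y hy hxy => ?_,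
    fun x hx => ?_⟩
  · by_cases hS : x ∈ X \ S
    · simpa only [dif_pos hS] using (he x hS).1
    · simp only [dif_neg hS]
      simpa [hx] using hS
  · by_cases hxS : x ∈ X \ S <;> by_cases hyS : y ∈ X \ S <;>
      simp only [dif_pos, dif_neg, hxS, hyS, not_false_eq_true] at hxy
    · simpa using e.injective (Subtype.ext hxy)
    · exact absurd (hxy ▸ hy) (he x hxS).2
    · exact absurd (hxy ▸ hx) (he y hyS).2
    · exact hxy
  · exact dif_neg (by simp [hx])

/-- Deleting the rows outside `R'`: the terminals in them move inside their columns, and at most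
one pair is joined inside the deleted rows. -/
theorem GridLinked.of_subset_rows {R R' : Finset α} {C : Finset β} {I I' : Finset ι}
    [DecidableEq ι] {T : ι × Bool → α × β} (hT : Placement R C I T) (hR : R' ⊆ R) (hI : I' ⊆ I)
    (hcol : ∀ c ∈ C, #{x ∈ terminals I' T | x.2 = c} ≤ #R') (B : Set (α × β))
    (hB : ∀ x ∈ B, x.1 ∈ R ∧ x.2 ∈ C ∧ x.1 ∉ R' ∧ x ∉ terminals I' T)
    (hBj : ∀ i ∈ I, i ∉ I' → GridJoined B (T (i, false)) (T (i, true)))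
    (hone : ∀ i ∈ I, ∀ j ∈ I, i ∉ I' → j ∉ I' → i = j)
    (ih : ∀ T', Placement R' C I' T' → GridLinked R' C I' T') : GridLinked R C I T := by
  have hT' := hT.mono hI
  have hmove : ∀ c : β, ∃ f : α → α, c ∈ C →
      (∀ x ∈ terminals I' T, x.2 = c → f x.1 ∈ R') ∧
      (∀ x ∈ terminals I' T, ∀ y ∈ terminals I' T, x.2 = c → y.2 = c → f x.1 = f y.1 → x = y) ∧
      ∀ a ∈ R', f a = a := by
    intro c
    by_cases hc : c ∈ C
    · obtain ⟨f, h1, h2, h3⟩ := exists_injOn_mapsTo_fix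
        ({x ∈ terminals I' T | x.2 = c}.image Prod.fst) R' (card_image_le.trans (hcol c hc))
      have hm : ∀ x ∈ terminals I' T, x.2 = c →
          x.1 ∈ {x ∈ terminals I' T | x.2 = c}.image Prod.fst := fun x hx hxc =>
        mem_image_of_mem _ (mem_filter.2 ⟨hx, hxc⟩)
      exact ⟨f, fun _ => ⟨fun x hx hxc => h1 _ (hm x hx hxc), fun x hx y hy hxc hyc h =>
        Prod.ext (h2 _ (hm x hx hxc) _ (hm y hy hyc) h) (hxc.trans hyc.symm), h3⟩⟩
    · exact ⟨id, fun h => absurd h hc⟩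
  choose f hf using hmove
  have hmem : ∀ i ∈ I', ∀ b, T (i, b) ∈ terminals I' T := fun i hi b =>
    mem_terminals.2 ⟨i, hi, b, rfl⟩
  obtain ⟨A, hA, hAd⟩ := ih (fun p => (f (T p).2 (T p).1, (T p).2))
    { row_mem := fun i hi b => (hf _ (hT'.col_mem i hi b)).1 _ (hmem i hi b) rfl
      col_mem := fun i hi b => hT'.col_mem i hi b
      inj := by
        intro i hi j hj b b' h
        obtain ⟨h1, h2⟩ := Prod.ext_iff.1 h
        simp only at h1 h2
        refine hT'.inj i hi j hj b b' ((hf _ (hT'.col_mem i hi b)).2.1 _ (hmem i hi b) _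
          (hmem j hj b') rfl h2.symm ?_)
        rw [h1, h2] }
  have hend : ∀ i ∈ I', ∀ b, (f (T (i, b)).2 (T (i, b)).1, (T (i, b)).2) ∈ A i := by
    rintro i hi (_ | _)
    · exact (hA i hi).2.left_mem
    · exact (hA i hi).2.right_mem
  -- A terminal already in the rows `R'` is fixed by the sliding, so its cell belongs to its own `A
  -- i`.
  have hTA : ∀ i ∈ I', ∀ j ∈ I', i ≠ j → ∀ b, T (i, b) ∉ A j := by
    intro i hi j hj hij b hb
    have h1 := ((hA j hj).1 _ hb).1
    have h2 := hend i hi b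
    rw [(hf _ (hT'.col_mem i hi b)).2.2 _ h1] at h2
    exact Set.disjoint_left.1 (hAd i hi j hj hij) h2 hb
  have hIB : ∀ i ∈ I', Disjoint (A i ∪ {x | ∃ b, T (i, b) = x}) B := by
    intro i hi
    rw [Set.disjoint_left]
    rintro x (hx | ⟨b, rfl⟩) hxB
    · exact (hB x hxB).2.2.1 ((hA i hi).1 x hx).1
    · exact (hB _ hxB).2.2.2 (hmem i hi b)
  refine ⟨fun i => if i ∈ I' then A i ∪ {x | ∃ b, T (i, b) = x} else B, fun i hi => ?_,
    fun i hi j hj hij => ?_⟩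
  · by_cases hi' : i ∈ I'
    · simp only [if_pos hi']
      refine ⟨?_, ?_⟩
      · rintro x (hx | ⟨b, rfl⟩)
        · exact ⟨hR ((hA i hi').1 x hx).1, ((hA i hi').1 x hx).2⟩
        · exact ⟨hT.row_mem i hi b, hT.col_mem i hi b⟩
      · have hb : ∀ b, T (i, b) ∈ A i ∪ {x | ∃ b, T (i, b) = x} := fun b => Or.inr ⟨b, rfl⟩
        exact GridJoined.head (hb false)
          (v := (f (T (i, false)).2 (T (i, false)).1, (T (i, false)).2)) (Or.inr rfl)
          (((hA i hi').2.mono Set.subset_union_left).tail (hb true) (Or.inr rfl))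
    · simp only [if_neg hi']
      exact ⟨fun x hx => ⟨(hB x hx).1, (hB x hx).2.1⟩, hBj i hi hi'⟩
  · by_cases hi' : i ∈ I' <;> by_cases hj' : j ∈ I' <;>
      simp only [if_pos, if_neg, hi', hj', not_false_eq_true]
    · rw [Set.disjoint_left]
      rintro x (hx | ⟨b, rfl⟩) (hx' | ⟨b', hb'⟩)
      · exact Set.disjoint_left.1 (hAd i hi' j hj' hij) hx hx'
      · exact hTA j hj' i hi' hij.symm b' (hb' ▸ hx)
      · exact hTA i hi' j hj' hij b hx'
      · exact hij (hT.inj j hj i hi b' b hb').1.symm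
    · exact hIB i hi'
    · exact (hIB j hj').symm
    · exact absurd (hone i hi j hj hi' hj') hij

end Basic

/-! ### Deleting rows, and greedy colouring. -/

section Reduction

variable {α β ι : Type*} [DecidableEq α] [DecidableEq β]
  {R : Finset α} {C : Finset β} {I : Finset ι} {T : ι × Bool → α × β}

theorem terminals_mono {J : Finset ι} (h : J ⊆ I) : terminals J T ⊆ terminals I T :=
  image_subset_image (product_subset_product_left h)

theorem Placement.apply_mem_terminals (_ : Placement R C I T) {i : ι} (hi : i ∈ I) (b : Bool) :
    T (i, b) ∈ terminals I T := mem_terminals.2 ⟨i, hi, b, rfl⟩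

/-- If every pair is given an empty row, and pairs with a common column get different rows, then
the pairs are linked through these rows. -/
theorem GridLinked.of_rows_through (hT : Placement R C I T) (f : ι → α) (hf : ∀ i ∈ I, f i ∈ R)
    (hfT : ∀ i ∈ I, ∀ x ∈ terminals I T, x.1 ≠ f i)
    (hd : ∀ i ∈ I, ∀ j ∈ I, i ≠ j → (∃ b b', (T (i, b)).2 = (T (j, b')).2) → f i ≠ f j) :
    GridLinked R C I T := by
  refine ⟨fun i => {x | ∃ b, x = T (i, b) ∨ x = (f i, (T (i, b)).2)}, fun i hi => ⟨?_, ?_⟩,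
    fun i hi j hj hij => ?_⟩
  · rintro x ⟨b, rfl | rfl⟩
    · exact ⟨hT.row_mem i hi b, hT.col_mem i hi b⟩
    · exact ⟨hf i hi, hT.col_mem i hi b⟩
  · refine GridJoined.head ⟨false, Or.inl rfl⟩ (v := (f i, (T (i, false)).2)) (Or.inr rfl)
      (GridJoined.head ⟨false, Or.inr rfl⟩ (v := (f i, (T (i, true)).2)) (Or.inl rfl)
        (GridJoined.head ⟨true, Or.inr rfl⟩ (v := T (i, true)) (Or.inr rfl)
          (GridJoined.refl ⟨true, Or.inl rfl⟩)))
  · rw [Set.disjoint_left]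
    rintro x ⟨b, rfl | rfl⟩ ⟨b', h | h⟩
    · exact hij (hT.inj i hi j hj b b' h).1
    · exact hfT j hj _ (hT.apply_mem_terminals hi b) (congrArg Prod.fst h)
    · exact hfT i hi _ (hT.apply_mem_terminals hj b') (congrArg Prod.fst h).symm
    · exact hd i hi j hj hij ⟨b, b', by simpa using congrArg Prod.snd h⟩ (congrArg Prod.fst h)

variable [DecidableEq ι]

theorem Placement.notMem_terminals_erase (hT : Placement R C I T) {i : ι} (hi : i ∈ I) (b : Bool) :
    T (i, b) ∉ terminals (I.erase i) T := by
  rw [mem_terminals]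
  rintro ⟨j, hj, b', h⟩
  exact ne_of_mem_erase hj (hT.inj j (mem_of_mem_erase hj) i hi b' b h).1

/-- A pair joined inside its two rows, through the column `y`, can be deleted with these rows. -/
theorem GridLinked.of_two_rows (hT : Placement R C I T) (hk : 2 * #I + 2 = #R + #C) {i : ι}
    (hi : i ∈ I) {y : β} (hy : y ∈ C) (h1 : ((T (i, false)).1, y) ∉ terminals (I.erase i) T)
    (h2 : ((T (i, true)).1, y) ∉ terminals (I.erase i) T)
    (hcol : ∀ c ∈ C, #{x ∈ terminals (I.erase i) T | x.2 = c} ≤ #R - 2)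
    (ih : ∀ (R' : Finset α) (C' : Finset β) (J : Finset ι) (T' : ι × Bool → α × β),
      #R' + #C' < #R + #C → 2 * #J + 2 ≤ #R' + #C' → Placement R' C' J T' →
      GridLinked R' C' J T') : GridLinked R C I T := by
  set s := T (i, false) with hs
  set t := T (i, true) with ht
  have hsX := hT.notMem_terminals_erase hi false
  have htX := hT.notMem_terminals_erase hi true
  have hsR := hT.row_mem i hi false
  have htR := hT.row_mem i hi true
  have hsC := hT.col_mem i hi false
  have htC := hT.col_mem i hi true
  rw [← hs] at hsX hsR hsC
  rw [← ht] at htX htR htC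
  -- The two rows may coincide; a lower bound is enough because `ih` asks only for an inequality.
  have hcard : #R - 2 ≤ #(R \ {s.1, t.1}) :=
    (Nat.sub_le_sub_left card_le_two _).trans (le_card_sdiff _ _)
  have hlt : #(R \ {s.1, t.1}) < #R :=
    card_lt_card ⟨sdiff_subset, fun h => by simpa using h hsR⟩
  have hI := card_erase_add_one hi
  have hone : ∀ j ∈ I, j ∉ I.erase i → j = i := fun j hj hj' => by
    by_contra hne
    exact hj' (mem_erase.2 ⟨hne, hj⟩)
  refine GridLinked.of_subset_rows hT (R' := R \ {s.1, t.1}) sdiff_subset (erase_subset i I)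
    (fun c hc => (hcol c hc).trans hcard) {s, (s.1, y), (t.1, y), t} ?_ ?_ ?_
    (fun T' hT' => ih _ _ _ _ (by omega) (by omega) hT')
  · rintro x (rfl | rfl | rfl | rfl)
    · exact ⟨hsR, hsC, by simp, hsX⟩
    · exact ⟨hsR, hy, by simp, h1⟩
    · exact ⟨htR, hy, by simp, h2⟩
    · exact ⟨htR, htC, by simp, htX⟩
  · intro j hj hj'
    rw [hone j hj hj', ← hs, ← ht]
    refine GridJoined.head (by simp) (v := (s.1, y)) (Or.inl rfl)
      (GridJoined.head (by simp) (v := (t.1, y)) (Or.inr rfl)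
        (GridJoined.head (by simp) (v := t) (Or.inl rfl) (GridJoined.refl (by simp))))
  · intro j hj j' hj' h h'
    rw [hone j hj h, hone j' hj' h']

/-- A row can be deleted if no column is full of terminals and the number of pairs allows it. -/
theorem GridLinked.of_one_row (hT : Placement R C I T) (hk : 2 * #I + 3 ≤ #R + #C)
    (hR : R.Nonempty) (hcol : ∀ c ∈ C, #{x ∈ terminals I T | x.2 = c} + 1 ≤ #R)
    (ih : ∀ (R' : Finset α) (C' : Finset β) (J : Finset ι) (T' : ι × Bool → α × β),
      #R' + #C' < #R + #C → 2 * #J + 2 ≤ #R' + #C' → Placement R' C' J T' →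
      GridLinked R' C' J T') : GridLinked R C I T := by
  obtain ⟨r, hr⟩ := hR
  have hcard := card_erase_add_one hr
  refine GridLinked.of_subset_rows hT (erase_subset r R) (subset_refl I)
    (fun c hc => ?_) ∅ (by simp) (fun i hi hi' => absurd hi hi')
    (fun i hi _ _ hi' => absurd hi hi') (fun T' hT' => ih _ _ _ _ (by omega) (by omega) hT')
  have := hcol c hc
  omega

/-- Greedy colouring: each new vertex has fewer conflicting neighbours than there are colours in
`E`. -/
theorem exists_colouring {γ : Type*} [DecidableEq γ] [Nonempty γ] (conf : ι → ι → Prop)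
    (hsymm : ∀ i j, conf i j → conf j i) (E : Finset γ) (S : Finset ι)
    (h : ∀ i ∈ S, ∃ J : Finset ι, #J < #E ∧ ∀ j ∈ S, j ≠ i → conf i j → j ∈ J) :
    ∃ f : ι → γ, (∀ i ∈ S, f i ∈ E) ∧ ∀ i ∈ S, ∀ j ∈ S, i ≠ j → conf i j → f i ≠ f j := by
  induction S using Finset.induction_on with
  | empty =>
    exact ⟨fun _ => Classical.arbitrary γ, by simp, by simp⟩
  | insert a S ha ih =>
    obtain ⟨f, hfE, hf⟩ := ih fun i hi => by
      obtain ⟨J, hJ, hJ'⟩ := h i (mem_insert_of_mem hi)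
      exact ⟨J, hJ, fun j hj => hJ' j (mem_insert_of_mem hj)⟩
    obtain ⟨J, hJ, hJ'⟩ := h a (mem_insert_self a S)
    obtain ⟨e, heE, he⟩ := exists_mem_notMem_of_card_lt_card
      (card_image_le.trans_lt hJ : #(J.image f) < #E)
    have hfe : ∀ j ∈ S, conf a j → f j ≠ e := fun j hj hc h =>
      he (h ▸ mem_image_of_mem f (hJ' j (mem_insert_of_mem hj) (fun h => ha (h ▸ hj)) hc))
    have hne : ∀ j ∈ S, j ≠ a := fun j hj h => ha (h ▸ hj)
    refine ⟨Function.update f a e, fun i hi => ?_, fun i hi j hj hij hc => ?_⟩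
    · obtain rfl | hi := mem_insert.1 hi
      · simpa using heE
      · simpa [hne i hi] using hfE i hi
    · obtain rfl | hi' := mem_insert.1 hi <;> obtain rfl | hj' := mem_insert.1 hj
      · exact absurd rfl hij
      · simpa [hne j hj'] using (hfe j hj' hc).symm
      · simpa [hne i hi'] using hfe i hi' (hsymm _ _ hc)
      · simpa [hne i hi', hne j hj'] using hf i hi' j hj' hij hc

theorem two_mul_card_sdiff_add_le {γ δ : Type*} [DecidableEq δ] (X : Finset γ) (f : γ → δ)
    (E D : Finset δ) (h : ∀ y ∈ E, 2 ≤ #{x ∈ X | f x = y}) :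
    2 * #(E \ D) + #{x ∈ X | f x ∈ D} ≤ #X := by
  have h1 : 2 * #(E \ D) ≤ #{x ∈ X | f x ∈ E \ D} := by
    refine mul_card_image_le_card_of_maps_to (f := f) (fun x hx => (mem_filter.1 hx).2) 2
      fun y hy => (h y (mem_sdiff.1 hy).1).trans (card_le_card fun x hx => ?_)
    obtain ⟨hxX, rfl⟩ := mem_filter.1 hx
    exact mem_filter.2 ⟨mem_filter.2 ⟨hxX, hy⟩, rfl⟩
  have h2 : #{x ∈ X | f x ∈ E \ D} ≤ #{x ∈ X | f x ∉ D} :=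
    card_le_card (monotone_filter_right X fun x _ hx => (mem_sdiff.1 hx).2)
  have := card_filter_add_card_filter_not (s := X) (fun x => f x ∈ D)
  omega

end Reduction

/-! ### The tight case: routing through empty rows. -/

section Tight

variable {α β ι : Type*} [DecidableEq α] [DecidableEq β]
  {R : Finset α} {C : Finset β} {I : Finset ι} {T : ι × Bool → α × β}

/-- Two-element sets that pairwise intersect have a common point or lie in a set of three
points. -/
theorem exists_common_or_card_le_three {p : ι → Bool → α} {I : Finset ι} (hI : I.Nonempty)
    (h : ∀ i ∈ I, ∀ j ∈ I, ∃ b b', p i b = p j b') :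
    (∃ a, ∀ i ∈ I, ∃ b, p i b = a) ∨ ∃ D : Finset α, #D ≤ 3 ∧ ∀ i ∈ I, ∀ b, p i b ∈ D := by
  by_contra! hcon
  obtain ⟨hcom, hthree⟩ := hcon
  obtain ⟨i, hi⟩ := hI
  obtain ⟨j, hj, hj'⟩ := hcom (p i false)
  obtain ⟨l, hl, hl'⟩ := hcom (p i true)
  -- The sets `i`, `j`, `l` form a triangle on `p i false`, `p i true`, `x`. A set `q` with a point
  -- outside it meets both `i` and `j` only in `p i true`, hence misses `l`.
  obtain ⟨x, hx⟩ : ∃ x, ∀ b, p j b = p i true ∨ p j b = x := by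
    obtain ⟨b, b', hb⟩ := h i hi j hj
    cases b
    · exact absurd hb.symm (hj' b')
    · exact ⟨p j !b', fun c => by cases b' <;> cases c <;> simp [hb]⟩
  obtain ⟨q, hq, b, hb⟩ := hthree {p i false, p i true, x} card_le_three
  simp only [mem_insert, mem_singleton, not_or] at hb
  obtain ⟨hb0, hb1, hbx⟩ := hb
  obtain ⟨c, c', hc⟩ := h q hq i hi
  obtain ⟨d, d', hd⟩ := h q hq j hj
  obtain ⟨e, e', he⟩ := h q hq l hl
  obtain ⟨u, u', hu⟩ := h j hj l hl
  obtain ⟨v, v', hv⟩ := h i hi l hl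
  have hcb : c = !b := by
    refine Bool.eq_not.2 ?_
    rintro rfl
    cases c' <;> contradiction
  have hdb : d = !b := by
    refine Bool.eq_not.2 ?_
    rintro rfl
    obtain h | h := hx d' <;> rw [h] at hd <;> contradiction
  have hqb : p q (!b) = p i true := by
    subst hcb hdb
    cases c'
    · exact absurd (hd.symm.trans hc) (hj' d')
    · exact hc
  have heb : e = b := by
    by_contra hne
    rw [Bool.eq_not.2 hne, hqb] at he
    exact hl' e' he.symm
  have hux : p l u' = x := by
    rw [← hu]
    exact (hx u).resolve_left fun h => hl' u' (hu.symm.trans h)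
  have hlv : p l v' = p i false := by
    cases v
    · exact hv.symm
    · exact absurd hv.symm (hl' v')
  have huv : u' ≠ v' := by
    rintro rfl
    exact hj' u (hu.trans hlv)
  subst heb
  by_cases heu : e' = u'
  · exact hbx (by rw [he, heu, hux])
  · have : e' = v' := by
      rw [Bool.eq_not.2 heu, Bool.eq_not.2 huv.symm]
    exact hb0 (by rw [he, this, hlv])

variable [DecidableEq ι]

/-- In every line through a terminal there are at least two terminals, if both corners of the
rectangle spanned by each pair are terminals of other pairs. -/
theorem Placement.two_le_card_row (hT : Placement R C I T)
    (hcor : ∀ i ∈ I, ∀ b, ((T (i, b)).1, (T (i, !b)).2) ∈ terminals (I.erase i) T)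
    {x : α × β} (hx : x ∈ terminals I T) : 2 ≤ #{y ∈ terminals I T | y.1 = x.1} := by
  obtain ⟨i, hi, b, rfl⟩ := mem_terminals.1 hx
  refine one_lt_card.2 ⟨_, mem_filter.2 ⟨hx, rfl⟩, _,
    mem_filter.2 ⟨terminals_mono (erase_subset i I) (hcor i hi b), rfl⟩, fun h => ?_⟩
  exact hT.notMem_terminals_erase hi b (h ▸ hcor i hi b)

theorem Placement.two_le_card_col (hT : Placement R C I T)
    (hcor : ∀ i ∈ I, ∀ b, ((T (i, b)).1, (T (i, !b)).2) ∈ terminals (I.erase i) T)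
    {x : α × β} (hx : x ∈ terminals I T) : 2 ≤ #{y ∈ terminals I T | y.2 = x.2} := by
  have := hT.swap.two_le_card_row (x := x.swap) (fun i hi b => by
    simpa [mem_terminals_swap] using hcor i hi !b) (by simpa [mem_terminals_swap] using hx)
  rwa [card_filter_terminals_swap] at this

/-- If the two rows of a pair have no common free column, they contain many terminals. -/
theorem Placement.card_add_two_le (hT : Placement R C I T) {i : ι} (hi : i ∈ I)
    (h : ∀ y ∈ C, ∃ b, ((T (i, b)).1, y) ∈ terminals (I.erase i) T) :
    #C + 2 ≤ #{x ∈ terminals I T | x.1 ∈ ({(T (i, false)).1, (T (i, true)).1} : Finset α)} := by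
  set D : Finset α := {(T (i, false)).1, (T (i, true)).1} with hD
  have hmem : ∀ b, (T (i, b)).1 ∈ D := by
    rintro (_ | _) <;> simp [hD]
  have h1 : #C ≤ #{x ∈ terminals (I.erase i) T | x.1 ∈ D} := by
    refine (card_le_card fun y hy => ?_).trans (card_image_le (f := Prod.snd))
    obtain ⟨b, hb⟩ := h y hy
    exact mem_image.2 ⟨_, mem_filter.2 ⟨hb, hmem b⟩, rfl⟩
  have h2 : #(univ.image fun b => T (i, b)) = 2 := by
    rw [card_image_of_injective _ fun b b' hb => (hT.inj i hi i hi b b' hb).2]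
    rfl
  have h3 : Disjoint ({x ∈ terminals (I.erase i) T | x.1 ∈ D}) (univ.image fun b => T (i, b)) := by
    rw [disjoint_right]
    intro x hx hx'
    obtain ⟨b, -, rfl⟩ := mem_image.1 hx
    exact hT.notMem_terminals_erase hi b (mem_filter.1 hx').1
  rw [← h2]
  refine (Nat.add_le_add_right h1 _).trans ?_
  rw [← card_union_of_disjoint h3]
  refine card_le_card (union_subset (filter_subset_filter _ (terminals_mono (erase_subset i I))) ?_)
  intro x hx
  obtain ⟨b, -, rfl⟩ := mem_image.1 hx
  exact mem_filter.2 ⟨hT.apply_mem_terminals hi b, hmem b⟩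

/-- The tight case in which the rectangle of every pair has terminals in its corners, every column
contains a terminal, and no pair has a common free column in its two rows: every pair is linked
through an empty row. -/
theorem GridLinked.of_no_empty_col (hT : Placement R C I T) (hk : 2 * #I + 2 = #R + #C)
    (hcor : ∀ i ∈ I, ∀ b, ((T (i, b)).1, (T (i, !b)).2) ∈ terminals (I.erase i) T)
    (hne : ∀ c ∈ C, ∃ x ∈ terminals I T, x.2 = c)
    (hfree : ∀ i ∈ I, ∀ y ∈ C, (∀ c ∈ C, #{x ∈ terminals (I.erase i) T | x.2 = c} ≤ #R - 2) →
      ∃ b, ((T (i, b)).1, y) ∈ terminals (I.erase i) T) : GridLinked R C I T := by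
  set X := terminals I T with hX
  set H := X.image Prod.fst with hH
  have hXcard : #X = 2 * #I := hT.card_terminals
  have hrow : ∀ D : Finset α, 2 * #(H \ D) + #{x ∈ X | x.1 ∈ D} ≤ 2 * #I := fun D => by
    rw [← hXcard]
    refine two_mul_card_sdiff_add_le X Prod.fst H D fun y hy => ?_
    obtain ⟨x, hx, rfl⟩ := mem_image.1 hy
    exact hT.two_le_card_row hcor hx
  have hcol : ∀ D : Finset β, 2 * #(C \ D) + #{x ∈ X | x.2 ∈ D} ≤ 2 * #I := fun D => by
    rw [← hXcard]
    refine two_mul_card_sdiff_add_le X Prod.snd C D fun y hy => ?_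
    obtain ⟨x, hx, rfl⟩ := hne y hy
    exact hT.two_le_card_col hcor hx
  have hHI : #H ≤ #I := by
    have := hrow ∅
    simp only [sdiff_empty] at this
    omega
  have hCI : #C ≤ #I := by
    have := hcol ∅
    simp only [sdiff_empty] at this
    omega
  -- Tightness with `#C ≤ #I` and `#H ≤ #I` gives `#H + 2 ≤ #R`, so no column is too crowded for
  -- `hfree`.
  have hrows : ∀ i ∈ I, #C + 2 ≤
      #{x ∈ X | x.1 ∈ ({(T (i, false)).1, (T (i, true)).1} : Finset α)} := by
    refine fun i hi => hT.card_add_two_le hi fun y hy => hfree i hi y hy fun c _ => ?_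
    have : #{x ∈ terminals (I.erase i) T | x.2 = c} ≤ #H := by
      refine card_le_card_of_injOn Prod.fst (fun x hx => mem_image_of_mem _
        (terminals_mono (erase_subset i I) (mem_filter.1 hx).1)) fun x hx y hy h => ?_
      exact Prod.ext h ((mem_filter.1 hx).2.trans (mem_filter.1 hy).2.symm)
    omega
  have hE : #R - #H ≤ #(R \ H) := le_card_sdiff H R
  have hconf : ∀ i ∈ I, ∃ J : Finset ι, #J < #(R \ H) ∧
      ∀ j ∈ I, j ≠ i → (∃ b b', (T (i, b)).2 = (T (j, b')).2) → j ∈ J := by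
    intro i hi
    by_cases hbig : #I ≤ #(R \ H)
    · exact ⟨I.erase i, by have := card_erase_add_one hi; omega,
        fun j hj hji _ => mem_erase.2 ⟨hji, hj⟩⟩
    have hsmall : #C = #I := by
      by_contra hlt
      refine hbig ?_
      by_cases hdis : ∀ i ∈ I, ∀ j ∈ I, ∃ b b', (T (i, b)).1 = (T (j, b')).1
      · obtain ⟨a, ha⟩ | ⟨D, hD, hD'⟩ := exists_common_or_card_le_three
          (p := fun i b => (T (i, b)).1) ⟨i, hi⟩ hdis
        · choose! b hb using ha
          have : #I ≤ #C := card_le_card_of_injOn (fun i => (T (i, b i)).2)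
            (fun i hi => hT.col_mem i hi _) fun i hi j hj hij =>
              (hT.inj i hi j hj _ _ (Prod.ext ((hb i hi).trans (hb j hj).symm) hij)).1
          omega
        · have : #H ≤ #D := card_le_card fun r hr => by
            obtain ⟨x, hx, rfl⟩ := mem_image.1 hr
            obtain ⟨i, hi, b, rfl⟩ := mem_terminals.1 hx
            exact hD' i hi b
          omega
      -- Two pairs without a common row occupy four rows holding at least `2 * #C + 4` terminals.
      -- The other occupied rows hold two each, so `#H + #C ≤ #I + 2`, which leaves `#I` empty rows.
      · push Not at hdis
        obtain ⟨j, hj, l, hl, hjl⟩ := hdis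
        have h1 := hrows j hj
        have h2 := hrows l hl
        set D : Finset α := {(T (j, false)).1, (T (j, true)).1} with hD
        set D' : Finset α := {(T (l, false)).1, (T (l, true)).1} with hD'
        have hDD : Disjoint D D' := by
          simp [hD, hD', Ne.symm (hjl _ _)]
        have h3 : #{x ∈ X | x.1 ∈ D ∪ D'} = #{x ∈ X | x.1 ∈ D} + #{x ∈ X | x.1 ∈ D'} := by
          rw [← card_union_of_disjoint, ← filter_or]
          · simp only [mem_union]
          · exact disjoint_filter.2 fun x _ hx hx' => disjoint_left.1 hDD hx hx'
        have h4 : #(D ∪ D') ≤ 4 :=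
          (card_union_le _ _).trans (Nat.add_le_add card_le_two card_le_two)
        have h5 := le_card_sdiff (D ∪ D') H
        have h6 := hrow (D ∪ D')
        omega
    -- Now `2 * #C` terminals lie at least two to a column, hence exactly two, so a pair conflicts
    -- with at most two others.
    have htwo : ∀ b, #{x ∈ terminals (I.erase i) T | x.2 = (T (i, b)).2} ≤ 1 := by
      intro b
      have h1 := hcol {(T (i, b)).2}
      simp only [mem_singleton] at h1
      have h2 := le_card_sdiff {(T (i, b)).2} C
      rw [card_singleton] at h2
      have h3 : #{x ∈ terminals (I.erase i) T | x.2 = (T (i, b)).2} <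
          #{x ∈ X | x.2 = (T (i, b)).2} := by
        refine card_lt_card ⟨filter_subset_filter _ (terminals_mono (erase_subset i I)), fun h => ?_⟩
        exact hT.notMem_terminals_erase hi b
          (mem_filter.1 (h (mem_filter.2 ⟨hT.apply_mem_terminals hi b, rfl⟩))).1
      omega
    refine ⟨{j ∈ I | j ≠ i ∧ ∃ b b', (T (i, b)).2 = (T (j, b')).2}, ?_,
      fun j hj hji h => mem_filter.2 ⟨hj, hji, h⟩⟩
    have h1 : #{j ∈ I | j ≠ i ∧ ∃ b b', (T (i, b)).2 = (T (j, b')).2} ≤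
        #({x ∈ terminals (I.erase i) T | x.2 = (T (i, false)).2} ∪
          {x ∈ terminals (I.erase i) T | x.2 = (T (i, true)).2}) := by
      have : ∀ j : ι, ∃ b', (∃ b b', (T (i, b)).2 = (T (j, b')).2) →
          ∃ b, (T (i, b)).2 = (T (j, b')).2 := fun j => by
        by_cases h : ∃ b b', (T (i, b)).2 = (T (j, b')).2
        · obtain ⟨b, b', h⟩ := h
          exact ⟨b', fun _ => ⟨b, h⟩⟩
        · exact ⟨false, fun h' => absurd h' h⟩
      choose c hc using this
      refine card_le_card_of_injOn (fun j => T (j, c j)) (fun j hj => ?_) fun j hj l hl h =>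
        (hT.inj j (mem_filter.1 hj).1 l (mem_filter.1 hl).1 _ _ h).1
      obtain ⟨hj, hji, hjc⟩ := mem_filter.1 hj
      obtain ⟨b, hb⟩ := hc j hjc
      have hjX : T (j, c j) ∈ terminals (I.erase i) T :=
        mem_terminals.2 ⟨j, mem_erase.2 ⟨hji, hj⟩, _, rfl⟩
      refine mem_union.2 ?_
      cases b
      · exact Or.inl (mem_filter.2 ⟨hjX, hb.symm⟩)
      · exact Or.inr (mem_filter.2 ⟨hjX, hb.symm⟩)
    have h2 := card_union_le {x ∈ terminals (I.erase i) T | x.2 = (T (i, false)).2}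
      {x ∈ terminals (I.erase i) T | x.2 = (T (i, true)).2}
    have h3 := htwo false
    have h4 := htwo true
    -- These give `2 * #H ≤ #I + 2`, hence at least `#H` empty rows; failure of `hbig` forces `#H ≥
    -- 3`, so three colours are available.
    have h5 := hrows i hi
    have h6 := hrow {(T (i, false)).1, (T (i, true)).1}
    have h7 : #H - 2 ≤ #(H \ {(T (i, false)).1, (T (i, true)).1}) :=
      (Nat.sub_le_sub_left card_le_two _).trans (le_card_sdiff _ _)
    omega
  by_cases hI : I.Nonempty
  · obtain ⟨i, hi⟩ := hI
    have : Nonempty α := ⟨(T (i, false)).1⟩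
    obtain ⟨f, hfE, hf⟩ := exists_colouring (fun i j => ∃ b b', (T (i, b)).2 = (T (j, b')).2)
      (fun i j ⟨b, b', h⟩ => ⟨b', b, h.symm⟩) (R \ H) I hconf
    refine GridLinked.of_rows_through hT f (fun i hi => (mem_sdiff.1 (hfE i hi)).1)
      (fun i hi x hx h => (mem_sdiff.1 (hfE i hi)).2 (h ▸ mem_image_of_mem _ hx)) hf
  · rw [not_nonempty_iff_eq_empty] at hI
    subst hI
    exact ⟨fun _ => ∅, by simp, by simp⟩

end Tight

/-! ### The induction on the size of the grid. -/

theorem gridLinked_of_placement {α β ι : Type*} [DecidableEq α] [DecidableEq β] [DecidableEq ι] :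
    ∀ (N : ℕ) (R : Finset α) (C : Finset β) (I : Finset ι) (T : ι × Bool → α × β),
      #R + #C < N → 2 * #I + 2 ≤ #R + #C → Placement R C I T → GridLinked R C I T := by
  intro N
  induction N with
  | zero => intro R C I T h; omega
  | succ N ihN =>
  intro R C I T hN hk hT
  have ih : ∀ (R' : Finset α) (C' : Finset β) (J : Finset ι) (T' : ι × Bool → α × β),
      #R' + #C' < #R + #C → 2 * #J + 2 ≤ #R' + #C' → Placement R' C' J T' →
      GridLinked R' C' J T' := fun R' C' J T' h => ihN R' C' J T' (by omega)
  have ih' : ∀ (R' : Finset β) (C' : Finset α) (J : Finset ι) (T' : ι × Bool → β × α),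
      #R' + #C' < #C + #R → 2 * #J + 2 ≤ #R' + #C' → Placement R' C' J T' →
      GridLinked R' C' J T' := fun R' C' J T' h1 h2 h3 =>
    (ih C' R' J (Prod.swap ∘ T') (by omega) (by omega) h3.swap).swap
  by_contra hcon
  have hcon' : ¬ GridLinked C R I (Prod.swap ∘ T) := fun h => hcon h.swap
  obtain rfl | ⟨i₀, hi₀⟩ := I.eq_empty_or_nonempty
  · exact hcon ⟨fun _ => ∅, by simp, by simp⟩
  have hR : R.Nonempty := ⟨_, hT.row_mem i₀ hi₀ false⟩
  have hC : C.Nonempty := ⟨_, hT.col_mem i₀ hi₀ false⟩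
  obtain hk | hk := hk.lt_or_eq
  · have h1 : ∃ c ∈ C, #R ≤ #{x ∈ terminals I T | x.2 = c} := by
      by_contra! h
      exact hcon (GridLinked.of_one_row hT hk hR h ih)
    have h2 : ∃ r ∈ R, #C ≤ #{x ∈ terminals I T | x.1 = r} := by
      by_contra! h
      refine hcon' (GridLinked.of_one_row hT.swap (by omega) hC (fun r hr => ?_) ih')
      rw [card_filter_terminals_swap]
      exact h r hr
    obtain ⟨c, -, hc⟩ := h1
    obtain ⟨r, -, hr⟩ := h2
    have := card_col_add_card_row_le (terminals I T) r c
    rw [hT.card_terminals] at this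
    omega
  have hrow : ∀ i ∈ I, ∀ y ∈ C,
      (∀ c ∈ C, #{x ∈ terminals (I.erase i) T | x.2 = c} ≤ #R - 2) →
      ∃ b, ((T (i, b)).1, y) ∈ terminals (I.erase i) T := by
    intro i hi y hy hcount
    by_contra! h
    exact hcon (GridLinked.of_two_rows hT hk hi hy (h false) (h true) hcount ih)
  have hcol : ∀ i ∈ I, ∀ x ∈ R,
      (∀ r ∈ R, #{x ∈ terminals (I.erase i) T | x.1 = r} ≤ #C - 2) →
      ∃ b, (x, (T (i, b)).2) ∈ terminals (I.erase i) T := by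
    intro i hi x hx hcount
    by_contra! h
    refine hcon' (GridLinked.of_two_rows hT.swap (by omega) hi hx ?_ ?_ (fun r hr => ?_) ih')
    · simpa [mem_terminals_swap] using h false
    · simpa [mem_terminals_swap] using h true
    · rw [card_filter_terminals_swap]
      exact hcount r hr
  -- The crowding conditions for rows and columns cannot both fail: a line of each kind would need
  -- `2 * #I` terminals in all, but the other pairs supply at most `2 * #I - 1`, one shared cell
  -- counted twice.
  have hboth : ∀ i ∈ I, ∀ y ∈ C, ∀ x ∈ R, (∃ b, ((T (i, b)).1, y) ∈ terminals (I.erase i) T) ∨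
      ∃ b, (x, (T (i, b)).2) ∈ terminals (I.erase i) T := by
    intro i hi y hy x hx
    by_contra! h
    have h1 : ∃ c ∈ C, #R - 2 < #{x ∈ terminals (I.erase i) T | x.2 = c} := by
      by_contra! hc
      obtain ⟨b, hb⟩ := hrow i hi y hy hc
      exact h.1 b hb
    have h2 : ∃ r ∈ R, #C - 2 < #{x ∈ terminals (I.erase i) T | x.1 = r} := by
      by_contra! hr
      obtain ⟨b, hb⟩ := hcol i hi x hx hr
      exact h.2 b hb
    obtain ⟨c, -, hc⟩ := h1
    obtain ⟨r, -, hr⟩ := h2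
    have := card_col_add_card_row_le (terminals (I.erase i) T) r c
    rw [(hT.mono (erase_subset i I)).card_terminals] at this
    have := card_erase_add_one hi
    omega
  have hcor : ∀ i ∈ I, ∀ b, ((T (i, b)).1, (T (i, !b)).2) ∈ terminals (I.erase i) T := by
    intro i hi b
    have hb := hT.notMem_terminals_erase hi b
    have hb' := hT.notMem_terminals_erase hi !b
    -- With this column and row, each alternative offers only the desired corner or a terminal of
    -- pair `i` itself.
    obtain ⟨b', h⟩ | ⟨b', h⟩ :=
      hboth i hi _ (hT.col_mem i hi !b) _ (hT.row_mem i hi b)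
    all_goals
      by_cases hbb : b' = b
      · subst hbb
        first | exact h | exact absurd h hb
      · rw [Bool.eq_not.2 hbb] at h
        first | exact h | exact absurd h hb'
  by_cases hC' : ∀ c ∈ C, ∃ x ∈ terminals I T, x.2 = c
  · exact hcon (GridLinked.of_no_empty_col hT hk hcor hC' hrow)
  by_cases hR' : ∀ r ∈ R, ∃ x ∈ terminals I T, x.1 = r
  · refine hcon' (GridLinked.of_no_empty_col hT.swap (by omega) (fun i hi b => ?_)
      (fun r hr => ?_) fun i hi x hx h => ?_)
    · simpa [mem_terminals_swap] using hcor i hi !b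
    · obtain ⟨x, hx, hxr⟩ := hR' r hr
      exact ⟨x.swap, by simpa [mem_terminals_swap] using hx, hxr⟩
    · simp only [card_filter_terminals_swap] at h
      obtain ⟨b, hb⟩ := hcol i hi x hx h
      exact ⟨b, by simpa [mem_terminals_swap] using hb⟩
  · push Not at hC' hR'
    obtain ⟨y, hy, hyX⟩ := hC'
    obtain ⟨x, hx, hxX⟩ := hR'
    obtain ⟨b, hb⟩ | ⟨b, hb⟩ := hboth i₀ hi₀ y hy x hx
    · exact hyX _ (terminals_mono (erase_subset i₀ I) hb) rfl
    · exact hxX _ (terminals_mono (erase_subset i₀ I) hb) rfl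

/-! ### From rook moves to walks in the product graph. -/

theorem GridJoined.exists_walk {α β : Type*} {A : Set (α × β)} {u v : α × β}
    (h : GridJoined A u v) :
    ∃ P : (SimpleGraph.boxProd (SimpleGraph.completeGraph α) (SimpleGraph.completeGraph β)).Walk
      u v, ∀ x ∈ P.support, x ∈ A := by
  obtain ⟨hu, h⟩ := h
  induction h with
  | refl => exact ⟨.nil, by simpa using hu⟩
  | @tail v w _ h ih =>
    obtain ⟨P, hP⟩ := ih
    -- `SameLine` is reflexive, so a rook move may stand still and yield no edge.
    by_cases hvw : v = w
    · exact ⟨P.copy rfl hvw, by simpa using hP⟩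
    · have hadj : (SimpleGraph.boxProd (SimpleGraph.completeGraph α)
          (SimpleGraph.completeGraph β)).Adj v w := by
        rw [SimpleGraph.boxProd_adj]
        obtain ⟨hw, h | h⟩ := h
        · exact Or.inr ⟨fun h' => hvw (Prod.ext h h'), h⟩
        · exact Or.inl ⟨fun h' => hvw (Prod.ext h' h), h⟩
      refine ⟨P.concat hadj, fun x hx => ?_⟩
      rw [SimpleGraph.Walk.support_concat] at hx
      simp only [List.mem_append, List.mem_singleton] at hx
      obtain hx | rfl := hx
      · exact hP x hx
      · exact h.1

theorem theorem2p1 (d₁ d₂ : ℕ) :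
    IsKLinked
      (SimpleGraph.boxProd (SimpleGraph.completeGraph (Fin (d₁ + 1)))
        (SimpleGraph.completeGraph (Fin (d₂ + 1))))
      ((d₁ + d₂) / 2) := by
  refine ⟨?_, fun s t hst => ?_⟩
  · rw [Fintype.card_prod, Fintype.card_fin, Fintype.card_fin]
    have : 2 * ((d₁ + d₂) / 2) ≤ d₁ + d₂ := Nat.mul_div_le _ _
    nlinarith
  · obtain ⟨A, hA, hd⟩ := gridLinked_of_placement _ univ univ univ
      (fun p : Fin ((d₁ + d₂) / 2) × Bool => if p.2 then t p.1 else s p.1) (Nat.lt_succ_self _)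
      (by simp only [card_univ, Fintype.card_fin]; omega)
      { row_mem := fun _ _ _ => mem_univ _
        col_mem := fun _ _ _ => mem_univ _
        inj := by
          rintro i - j - (_ | _) (_ | _) h
          · exact ⟨Sum.inl_injective (hst (a₁ := .inl i) (a₂ := .inl j) h), rfl⟩
          · exact absurd (hst (a₁ := .inl i) (a₂ := .inr j) h) Sum.inl_ne_inr
          · exact absurd (hst (a₁ := .inr i) (a₂ := .inl j) h) Sum.inr_ne_inl
          · exact ⟨Sum.inr_injective (hst (a₁ := .inr i) (a₂ := .inr j) h), rfl⟩ }
    have hP := fun i => (hA i (mem_univ i)).2.exists_walk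
    choose P hP using hP
    refine ⟨fun i => (P i).bypass, fun i => (P i).bypass_isPath, fun i j hij x hx hx' => ?_⟩
    exact Set.disjoint_left.1 (hd i (mem_univ i) j (mem_univ j) hij)
      (hP i x ((P i).support_bypass_subset_support hx))
      (hP j x ((P j).support_bypass_subset_support hx'))
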